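/- Let $\Omega=(0,1)\times(0,1)\subset\mathbb{R}^2$, let $\varepsilon>0$ and $\tau>0$, let $\Omega_I\subset\Omega$ and $\Omega_A=\Omega\setminus\Omega_I$. Let $H^1(\Omega)$ carry the norm $\|u\|_{H^1}^2=\|u\|_{L^2}^2+\|\nabla u\|_{L^2}^2$, let $Q=H^1_0(\Omega)$ be the closure of $C_c^\infty(\Omega)$ in $H^1(\Omega)$, and let $$\hat V=\{v\in H^1(\Omega): v=0 \text{ a.e. on } \Omega_A\}.$$ With $(\cdot,\cdot)$ the $L^2(\Omega)$ inner product, define the bilinear forms $$\hat a(u,v)=\varepsilon\Big((\nabla u,\nabla v)+\int_\Omega u\int_\Omega v\Big)\ \text{ on } \hat V\times\hat V,\qquad \hat b(v,q)=(v,q)\ \text{ on } \hat V\times H^1(\Omega),\qquad c(\lambda,q)=\tau(\nabla\lambda,\nabla q)\ \text{ on } H^1(\Omega)\times H^1(\Omega).$$ A bilinear form $B$ on a normed space $X$ with norm $\|\cdot\|_X$ is called coercive if there is $\alpha>0$ with $B(x,x)\ge\alpha\|x\|_X^2$ for all $x\in X$, and semi-coercive if its kernel $N=\{x\in X: B(x,y)=0\text{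 for all }y\in X\}$ is finite-dimensional and there is $\alpha>0$ with $B(x,x)\ge\alpha\,\operatorname{dist}_X(x,N)^2$ for all $x\in X$. A bilinear form $B$ on $X\times Y$ is bounded if there is a constant $C$ with $|B(x,y)|\le C\|x\|_X\|y\|_Y$ for all $x\in X$, $y\in Y$. Then, all spaces being equipped with the $H^1$ norm: 1. $\hat a$ is symmetric and coercive on $\hat V$; 2. $c$ is symmetric and semi-coercive on $H^1(\Omega)$, and its restriction to $Q\times Q$ is semi-coercive as well; 3. $\hat a$ (on $\hat V\times\hat V$), $\hat b$ (on $\hat V\times H^1(\Omega)$) and $c$ (on $H^1(\Omega)\times H^1(\Omega)$) are bounded. -/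

import Mathlib

open MeasureTheory
open scoped ContDiff

noncomputable section

namespace CahnHilliard

/-- The Euclidean plane. -/
abbrev Plane : Type := EuclideanSpace ℝ (Fin 2)

/-- The open unit square `(0,1) × (0,1)`. -/
def unitSquare : Set Plane := {x | ∀ i, x i ∈ Set.Ioo (0 : ℝ) 1}

/-- Test functions: elements of `C_c^∞(Ω)`. -/
structure IsTestFunction (Ω : Set Plane) (φ : Plane → ℝ) : Prop where
  contDiff : ContDiff ℝ ∞ φ
  hasCompactSupport : HasCompactSupport φ
  tsupport_subset : tsupport φ ⊆ Ω

/-- The partial derivative `∂φ/∂xᵢ`. -/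
def partialDeriv (i : Fin 2) (φ : Plane → ℝ) (x : Plane) : ℝ :=
  fderiv ℝ φ x (EuclideanSpace.single i 1)

/-- `L²(Ω)`. -/
abbrev L2 (Ω : Set Plane) : Type := Lp ℝ 2 (volume.restrict Ω)

/-- `L²(Ω; ℝ²)`. -/
abbrev L2Vec (Ω : Set Plane) : Type := Lp Plane 2 (volume.restrict Ω)

/-- `g` is the weak gradient of `u` on `Ω`. -/
def IsWeakGradient (Ω : Set Plane) (u : L2 Ω) (g : L2Vec Ω) : Prop :=
  ∀ φ : Plane → ℝ, IsTestFunction Ω φ → ∀ i : Fin 2,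
    ∫ x in Ω, u x * partialDeriv i φ x = -∫ x in Ω, g x i * φ x

lemma IsTestFunction.memLp {Ω : Set Plane} {φ : Plane → ℝ} (h : IsTestFunction Ω φ) :
    MemLp φ 2 (volume.restrict Ω) :=
  h.contDiff.continuous.memLp_of_hasCompactSupport h.hasCompactSupport

lemma IsTestFunction.memLp_partialDeriv {Ω : Set Plane} {φ : Plane → ℝ}
    (h : IsTestFunction Ω φ) (i : Fin 2) :
    MemLp (partialDeriv i φ) 2 (volume.restrict Ω) := by
  have hc : Continuous (partialDeriv i φ) :=
    (h.contDiff.continuous_fderiv (by simp)).clm_apply continuous_const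
  exact hc.memLp_of_hasCompactSupport (h.hasCompactSupport.fderiv_apply ℝ _)

lemma memLp_coord {Ω : Set Plane} (g : L2Vec Ω) (i : Fin 2) :
    MemLp (fun x => g x i) 2 (volume.restrict Ω) :=
  (EuclideanSpace.proj i : Plane →L[ℝ] ℝ).comp_memLp' (Lp.memLp g)

lemma integrable_left {Ω : Set Plane} (u : L2 Ω) {φ : Plane → ℝ} (h : IsTestFunction Ω φ)
    (i : Fin 2) : Integrable (fun x => u x * partialDeriv i φ x) (volume.restrict Ω) :=
  (Lp.memLp u).integrable_mul (h.memLp_partialDeriv i)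

lemma integrable_right {Ω : Set Plane} (g : L2Vec Ω) {φ : Plane → ℝ} (h : IsTestFunction Ω φ)
    (i : Fin 2) : Integrable (fun x => g x i * φ x) (volume.restrict Ω) :=
  (memLp_coord g i).integrable_mul h.memLp

/-- The pairs `(u, ∇u)` of an `L²` function `u` and its weak gradient in `L²`, as a subspace of
`L²(Ω) × L²(Ω; ℝ²)`. -/
def weakGradientGraph (Ω : Set Plane) : Submodule ℝ (WithLp 2 (L2 Ω × L2Vec Ω)) where
  carrier := {p | IsWeakGradient Ω p.fst p.snd}
  add_mem' := by
    intro p q hp hq φ h i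
    have h1 : ∫ x in Ω, (p + q).fst x * partialDeriv i φ x
        = ∫ x in Ω, (p.fst x * partialDeriv i φ x + q.fst x * partialDeriv i φ x) := by
      refine integral_congr_ae ?_
      filter_upwards [Lp.coeFn_add p.fst q.fst] with x hx
      rw [WithLp.add_fst, hx, Pi.add_apply, add_mul]
    have h2 : ∫ x in Ω, (p + q).snd x i * φ x
        = ∫ x in Ω, (p.snd x i * φ x + q.snd x i * φ x) := by
      refine integral_congr_ae ?_
      filter_upwards [Lp.coeFn_add p.snd q.snd] with x hx
      rw [WithLp.add_snd, hx, Pi.add_apply, PiLp.add_apply, add_mul]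
    rw [h1, h2, integral_add (integrable_left _ h i) (integrable_left _ h i),
      integral_add (integrable_right _ h i) (integrable_right _ h i), hp φ h i, hq φ h i, neg_add]
  zero_mem' := by
    intro φ h i
    have h1 : ∫ x in Ω, (0 : L2 Ω) x * partialDeriv i φ x = ∫ x in Ω, (0 : ℝ) := by
      refine integral_congr_ae ?_
      filter_upwards [Lp.coeFn_zero ℝ 2 (volume.restrict Ω)] with x hx
      rw [hx, Pi.zero_apply, zero_mul]
    have h2 : ∫ x in Ω, (0 : L2Vec Ω) x i * φ x = ∫ x in Ω, (0 : ℝ) := by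
      refine integral_congr_ae ?_
      filter_upwards [Lp.coeFn_zero Plane 2 (volume.restrict Ω)] with x hx
      rw [hx, Pi.zero_apply, PiLp.zero_apply, zero_mul]
    rw [WithLp.zero_fst, WithLp.zero_snd, h1, h2]
    simp
  smul_mem' := by
    intro r p hp φ h i
    have h1 : ∫ x in Ω, (r • p).fst x * partialDeriv i φ x
        = ∫ x in Ω, r * (p.fst x * partialDeriv i φ x) := by
      refine integral_congr_ae ?_
      filter_upwards [Lp.coeFn_smul r p.fst] with x hx
      rw [WithLp.smul_fst, hx, Pi.smul_apply, smul_eq_mul, mul_assoc]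
    have h2 : ∫ x in Ω, (r • p).snd x i * φ x = ∫ x in Ω, r * (p.snd x i * φ x) := by
      refine integral_congr_ae ?_
      filter_upwards [Lp.coeFn_smul r p.snd] with x hx
      rw [WithLp.smul_snd, hx, Pi.smul_apply, PiLp.smul_apply, smul_eq_mul, mul_assoc]
    rw [h1, h2, integral_const_mul, integral_const_mul, hp φ h i, mul_neg]

/-- The Sobolev space `H¹(Ω)`: the functions in `L²(Ω)` that have a weak gradient in `L²(Ω; ℝ²)`,
each stored together with that gradient, with the norm `‖u‖² = ‖u‖²_{L²} + ‖∇u‖²_{L²}` (inherited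
from `L²(Ω) × L²(Ω; ℝ²)`). The weak gradient on an open set is unique, see `H1.ext_val`. -/
def H1 (Ω : Set Plane) : Type := weakGradientGraph Ω

instance (Ω : Set Plane) : NormedAddCommGroup (H1 Ω) :=
  inferInstanceAs (NormedAddCommGroup (weakGradientGraph Ω))

instance (Ω : Set Plane) : InnerProductSpace ℝ (H1 Ω) :=
  inferInstanceAs (InnerProductSpace ℝ (weakGradientGraph Ω))

namespace H1

variable {Ω : Set Plane}

/-- The underlying `L²` function. -/
def val : H1 Ω →ₗ[ℝ] L2 Ω where
  toFun u := u.1.fst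
  map_add' _ _ := rfl
  map_smul' _ _ := rfl

/-- The weak gradient. -/
def grad : H1 Ω →ₗ[ℝ] L2Vec Ω where
  toFun u := u.1.snd
  map_add' _ _ := rfl
  map_smul' _ _ := rfl

lemma inner_eq (u v : H1 Ω) :
    inner ℝ u v = inner ℝ (val u) (val v) + inner ℝ (grad u) (grad v) := rfl

/-- On an open set, an element of `H¹(Ω)` is determined by the underlying `L²` function. -/
lemma ext_val (hΩ : IsOpen Ω) {u v : H1 Ω} (h : val u = val v) : u = v := by
  have hg : grad u = grad v := by
    have hi : ∀ i : Fin 2, ∀ᵐ x ∂(volume : Measure Plane),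
        x ∈ Ω → (grad u x i - grad v x i) = 0 := by
      intro i
      refine hΩ.ae_eq_zero_of_integral_contDiff_smul_eq_zero ?_ ?_
      · have hm : MemLp (fun x => grad u x i - grad v x i) 2 (volume.restrict Ω) :=
          (memLp_coord _ i).sub (memLp_coord _ i)
        rw [locallyIntegrableOn_iff hΩ.isLocallyClosed]
        intro k hk hkc
        have hm' : MemLp (fun x => grad u x i - grad v x i) 2 (volume.restrict k) :=
          hm.mono_measure (Measure.restrict_mono hk le_rfl)
        have : IsFiniteMeasure ((volume : Measure Plane).restrict k) :=
          ⟨by simpa using hkc.measure_lt_top⟩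
        exact hm'.integrable (by norm_num)
      · intro φ hφ hc hs
        have ht : IsTestFunction Ω φ := ⟨hφ, hc, hs⟩
        have e1 := u.2 φ ht i
        have e2 := v.2 φ ht i
        have e0 : ∫ x in Ω, u.1.fst x * partialDeriv i φ x
            = ∫ x in Ω, v.1.fst x * partialDeriv i φ x := by
          change ∫ x in Ω, val u x * _ = ∫ x in Ω, val v x * _
          rw [h]
        have e3 : ∫ x in Ω, u.1.snd x i * φ x = ∫ x in Ω, v.1.snd x i * φ x := by
          linarith
        have e4 : ∫ x, φ x • (grad u x i - grad v x i)
            = ∫ x in Ω, φ x • (grad u x i - grad v x i) := by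
          refine (setIntegral_eq_integral_of_forall_compl_eq_zero fun x hx => ?_).symm
          rw [image_eq_zero_of_notMem_tsupport (fun hh => hx (hs hh)), zero_smul]
        rw [e4]
        have e5 : ∫ x in Ω, φ x • (grad u x i - grad v x i)
            = ∫ x in Ω, (u.1.snd x i * φ x - v.1.snd x i * φ x) := by
          refine integral_congr_ae (Filter.Eventually.of_forall fun x => ?_)
          change φ x * (u.1.snd x i - v.1.snd x i) = _
          ring
        rw [e5, integral_sub (integrable_right _ ht i) (integrable_right _ ht i), e3, sub_self]
    refine Lp.ext ?_
    rw [Filter.EventuallyEq, ae_restrict_iff' hΩ.measurableSet]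
    filter_upwards [hi 0, hi 1] with x h0 h1 hx
    ext i
    fin_cases i
    · exact sub_eq_zero.mp (h0 hx)
    · exact sub_eq_zero.mp (h1 hx)
  refine Subtype.ext (WithLp.ofLp_injective 2 (Prod.ext h hg))

end H1

/-- `H₀¹(Ω)`: the closure of `C_c^∞(Ω)` in `H¹(Ω)`. -/
def H10 (Ω : Set Plane) : Submodule ℝ (H1 Ω) :=
  (Submodule.span ℝ {u : H1 Ω | ∃ φ : Plane → ℝ, IsTestFunction Ω φ ∧
    H1.val u =ᵐ[volume.restrict Ω] φ}).topologicalClosure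

/-- `{v ∈ H¹(Ω) : v = 0 on Ω \ ΩI}`, where `Ω` is the unit square. -/
def VHat (ΩI : Set Plane) : Submodule ℝ (H1 unitSquare) where
  carrier := {v | ∀ᵐ x ∂volume.restrict unitSquare, x ∈ unitSquare \ ΩI → H1.val v x = 0}
  add_mem' := by
    intro u v hu hv
    filter_upwards [hu, hv, Lp.coeFn_add (H1.val u) (H1.val v)] with x h1 h2 h3 hx
    rw [map_add, h3, Pi.add_apply, h1 hx, h2 hx, add_zero]
  zero_mem' := by
    filter_upwards [Lp.coeFn_zero ℝ 2 (volume.restrict unitSquare)] with x h _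
    rw [map_zero, h, Pi.zero_apply]
  smul_mem' := by
    intro r u hu
    filter_upwards [hu, Lp.coeFn_smul r (H1.val u)] with x h1 h2 hx
    rw [map_smul, h2, Pi.smul_apply, h1 hx, smul_zero]

lemma volume_unitSquare_lt_top : volume unitSquare < ⊤ := by
  refine (Bornology.IsBounded.subset (Metric.isBounded_closedBall (x := (0 : Plane)) (r := 2))
    fun x hx => ?_).measure_lt_top
  rw [mem_closedBall_zero_iff, EuclideanSpace.norm_eq, Fin.sum_univ_two]
  have h0 := hx 0
  have h1 := hx 1
  refine Real.sqrt_le_iff.mpr ⟨by norm_num, ?_⟩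
  simp only [Real.norm_eq_abs, sq_abs]
  nlinarith [h0.1, h0.2, h1.1, h1.2]

instance : IsFiniteMeasure ((volume : Measure Plane).restrict unitSquare) :=
  ⟨by simpa using volume_unitSquare_lt_top⟩

/-- The functional `u ↦ ∫_Ω u`. -/
def integralL : H1 unitSquare →ₗ[ℝ] ℝ where
  toFun u := ∫ x in unitSquare, H1.val u x
  map_add' u v := by
    rw [← integral_add ((Lp.memLp (H1.val u)).integrable (by norm_num))
      ((Lp.memLp (H1.val v)).integrable (by norm_num))]
    refine integral_congr_ae ?_
    filter_upwards [Lp.coeFn_add (H1.val u) (H1.val v)] with x h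
    rw [map_add, h, Pi.add_apply]
  map_smul' r u := by
    rw [RingHom.id_apply, smul_eq_mul, ← integral_const_mul]
    refine integral_congr_ae ?_
    filter_upwards [Lp.coeFn_smul r (H1.val u)] with x h
    rw [map_smul, h, Pi.smul_apply, smul_eq_mul]

/-- `(u, v) ↦ ε ((∇u, ∇v) + ∫_Ω u ∫_Ω v)` on `V̂ × V̂`. -/
def aHat (ε : ℝ) (ΩI : Set Plane) : VHat ΩI →ₗ[ℝ] VHat ΩI →ₗ[ℝ] ℝ :=
  LinearMap.mk₂ ℝ
    (fun u v => ε * (inner ℝ (H1.grad u.1) (H1.grad v.1) + integralL u.1 * integralL v.1))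
    (by intro u u' v; simp only [Submodule.coe_add, map_add, inner_add_left]; ring)
    (by intro r u v; simp only [Submodule.coe_smul, map_smul, real_inner_smul_left,
          smul_eq_mul]; ring)
    (by intro u v v'; simp only [Submodule.coe_add, map_add, inner_add_right]; ring)
    (by intro r u v; simp only [Submodule.coe_smul, map_smul, real_inner_smul_right,
          smul_eq_mul]; ring)

/-- `(v, q) ↦ (v, q)_{L²}` on `V̂ × H¹(Ω)`. -/
def bHat (ΩI : Set Plane) : VHat ΩI →ₗ[ℝ] H1 unitSquare →ₗ[ℝ] ℝ :=
  LinearMap.mk₂ ℝ (fun v q => inner ℝ (H1.val v.1) (H1.val q))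
    (by intro u u' v; simp only [Submodule.coe_add, map_add, inner_add_left])
    (by intro r u v; simp only [Submodule.coe_smul, map_smul, real_inner_smul_left, smul_eq_mul])
    (by intro u v v'; simp only [map_add, inner_add_right])
    (by intro r u v; simp only [map_smul, real_inner_smul_right, smul_eq_mul])

/-- `(q, r) ↦ τ (∇q, ∇r)` on `H¹(Ω) × H¹(Ω)`. -/
def cForm (τ : ℝ) : H1 unitSquare →ₗ[ℝ] H1 unitSquare →ₗ[ℝ] ℝ :=
  LinearMap.mk₂ ℝ (fun q r => τ * inner ℝ (H1.grad q) (H1.grad r))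
    (by intro u u' v; simp only [map_add, inner_add_left]; ring)
    (by intro r u v; simp only [map_smul, real_inner_smul_left, smul_eq_mul]; ring)
    (by intro u v v'; simp only [map_add, inner_add_right]; ring)
    (by intro r u v; simp only [map_smul, real_inner_smul_right, smul_eq_mul]; ring)

/-- The restriction of `cForm` to `H₀¹(Ω) × H₀¹(Ω)`. -/
def cForm₀ (τ : ℝ) : H10 unitSquare →ₗ[ℝ] H10 unitSquare →ₗ[ℝ] ℝ :=
  (cForm τ).domRestrict₁₂ (H10 unitSquare) (H10 unitSquare)

section Abstract

variable {X Y : Type*} [NormedAddCommGroup X] [NormedSpace ℝ X]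
  [NormedAddCommGroup Y] [NormedSpace ℝ Y]

/-- Bounded bilinear forms. -/
def IsBoundedForm (B : X →ₗ[ℝ] Y →ₗ[ℝ] ℝ) : Prop :=
  ∃ C : ℝ, ∀ x y, |B x y| ≤ C * ‖x‖ * ‖y‖

/-- Coercive bilinear forms. -/
def IsCoerciveForm (B : X →ₗ[ℝ] X →ₗ[ℝ] ℝ) : Prop :=
  ∃ α : ℝ, 0 < α ∧ ∀ x, α * ‖x‖ ^ 2 ≤ B x x

/-- Semi-coercive bilinear forms: the kernel `N = {x : B(x, ·) = 0}` is finite-dimensional, and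
`B(x, x) ≥ α dist(x, N)²` for some `α > 0`. -/
def IsSemicoerciveForm (B : X →ₗ[ℝ] X →ₗ[ℝ] ℝ) : Prop :=
  FiniteDimensional ℝ (LinearMap.ker B) ∧
    ∃ α : ℝ, 0 < α ∧ ∀ x, α * Metric.infDist x (LinearMap.ker B : Set X) ^ 2 ≤ B x x

end Abstract

end CahnHilliard

end

/-! Everything rests on the Poincaré–Wirtinger inequality `exists_norm_sub_smul_one_le`: each u in
H¹ of the square is within C‖∇u‖ of a constant. Weak gradients are defined by pairing with test
functions, so the inequality is proved by duality. A test function f is split as f = ∂₁P₁f + A₁f and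
A₁f = ∂₀P₀A₁f + A₀A₁f. Here Aᵢ (`avgOp`) spreads the integral of f along direction i over a fixed
bump, and Pᵢ (`primOp`) is a compactly supported primitive of f − Aᵢf. Both are L²-bounded, and
A₀A₁f is a multiple of the fixed function `eta₂`. Hence, up to a multiple of its pairing with
`eta₂`, the pairing of u with f is at most a constant times ‖∇u‖‖f‖ (`exists_abs_integral_sub_le`).
Subtracting the right constant from u and using the density of test functions gives the inequality.

The integral detects constants, so ‖u‖ ≤ C(‖∇u‖ + |∫u|), which yields coercivity of `aHat`. The
kernel of `cForm` is {∇u = 0}, the constants, and the inequality bounds the distance to it. For H¹₀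
there is no need to decide whether 1 belongs to it: a closed subspace either contains 1 or lies at
positive distance from it. Boundedness is Cauchy–Schwarz. -/

noncomputable section

namespace CahnHilliard

/-! ### Smoothness and derivatives of integrals along lines and half-lines -/

section LineIntegrals

variable {E : Type*} [NormedAddCommGroup E] [NormedSpace ℝ E]

lemma contDiff_integral_mul_comp_add_smul {f : E → ℝ} (hf : ContDiff ℝ ∞ f)
    (hc : HasCompactSupport f) {e : E} (he : e ≠ 0) {k : ℝ → ℝ} (hk : LocallyIntegrable k) :
    ContDiff ℝ ∞ (fun x => ∫ t, k t * f (x + t • e)) := by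
  obtain ⟨R, hR⟩ := hc.isCompact.isBounded.subset_closedBall (0 : E)
  have hfz : ∀ y, R < ‖y‖ → f y = 0 := fun y hy =>
    image_eq_zero_of_notMem_tsupport fun h => by
      have := hR h
      rw [mem_closedBall_zero_iff] at this
      linarith
  rw [contDiff_iff_contDiffAt]
  intro x₀
  -- The integral is the convolution at 0 of `k` with t ↦ f(x − te), where x is a parameter. Keeping
  -- x in a ball around `x₀` gives one compact set of t outside which every integrand vanishes.
  have key := contDiffOn_convolution_right_with_param_comp (𝕜 := ℝ) (μ := (volume : Measure ℝ))
    (n := ⊤) (ContinuousLinearMap.lsmul ℝ ℝ) (s := Metric.ball (0 : E) (‖x₀‖ + 1))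
    (v := fun _ => (0 : ℝ)) contDiffOn_const (f := k) (g := fun x t => f (x - t • e))
    (k := Metric.closedBall (0 : ℝ) ((R + (‖x₀‖ + 1)) / ‖e‖)) Metric.isOpen_ball
    (isCompact_closedBall _ _) ?_ hk ?_
  · have h2 := key.contDiffAt (Metric.isOpen_ball.mem_nhds (x := x₀) (by simp))
    refine h2.congr_of_eventuallyEq (Filter.Eventually.of_forall fun x => ?_)
    simp [convolution_def]
  · intro p t hp ht
    apply hfz
    rw [mem_closedBall_zero_iff, not_le, div_lt_iff₀ (norm_pos_iff.mpr he), ← norm_smul] at ht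
    rw [mem_ball_zero_iff] at hp
    have := norm_sub_norm_le (t • e) p
    rw [norm_sub_rev] at this
    linarith
  · exact (hf.comp (contDiff_fst.sub (contDiff_snd.smul contDiff_const))).contDiffOn

lemma hasCompactSupport_comp_add_smul {f : E → ℝ} (hc : HasCompactSupport f) {e : E} (he : e ≠ 0)
    (x : E) : HasCompactSupport (fun t : ℝ => f (x + t • e)) := by
  refine hc.comp_isClosedEmbedding (g := fun t : ℝ => x + t • e) ?_
  exact (Homeomorph.addLeft x).isClosedEmbedding.comp (isClosedEmbedding_smul_left he)

lemma integrable_comp_add_smul {f : E → ℝ} (hf : Continuous f) (hc : HasCompactSupport f) {e : E}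
    (he : e ≠ 0) (x : E) : Integrable (fun t : ℝ => f (x + t • e)) :=
  (hf.comp (by fun_prop)).integrable_of_hasCompactSupport (hasCompactSupport_comp_add_smul hc he x)

/-- The integral of `f` over the line through `x` in the direction `e`. -/
def lineIntegral (e : E) (f : E → ℝ) (x : E) : ℝ := ∫ t : ℝ, f (x + t • e)

/-- The integral of `f` over the half-line that ends at `x` in the direction `e`. -/
def rayIntegral (e : E) (f : E → ℝ) (x : E) : ℝ := ∫ t in Set.Iic (0 : ℝ), f (x + t • e)

lemma lineIntegral_add_smul (e : E) (f : E → ℝ) (x : E) (s : ℝ) :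
    lineIntegral e f (x + s • e) = lineIntegral e f x := by
  rw [lineIntegral, lineIntegral, ← integral_add_left_eq_self (fun t : ℝ => f (x + t • e)) s]
  simp only [add_smul, add_assoc]

lemma contDiff_lineIntegral {f : E → ℝ} (hf : ContDiff ℝ ∞ f) (hc : HasCompactSupport f) {e : E}
    (he : e ≠ 0) : ContDiff ℝ ∞ (lineIntegral e f) := by
  have := contDiff_integral_mul_comp_add_smul hf hc he (k := fun _ => 1) (locallyIntegrable_const 1)
  simp only [one_mul] at this
  exact this

lemma contDiff_rayIntegral {f : E → ℝ} (hf : ContDiff ℝ ∞ f) (hc : HasCompactSupport f) {e : E}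
    (he : e ≠ 0) : ContDiff ℝ ∞ (rayIntegral e f) := by
  have := contDiff_integral_mul_comp_add_smul hf hc he (k := (Set.Iic (0 : ℝ)).indicator 1)
    ((locallyIntegrable_const (1 : ℝ)).indicator measurableSet_Iic)
  convert this using 2 with x
  rw [rayIntegral, ← integral_indicator measurableSet_Iic]
  congr 1 with t
  by_cases ht : t ∈ Set.Iic (0 : ℝ) <;> simp [ht]

lemma rayIntegral_add_smul (e : E) (f : E → ℝ) (x : E) (s : ℝ) :
    rayIntegral e f (x + s • e) = ∫ t in Set.Iic s, f (x + t • e) := by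
  rw [rayIntegral, ← integral_indicator measurableSet_Iic, ← integral_indicator measurableSet_Iic,
    ← integral_add_left_eq_self ((Set.Iic s).indicator fun t : ℝ => f (x + t • e)) s]
  congr 1 with t
  simp only [Set.indicator_apply, Set.mem_Iic, add_le_iff_nonpos_right, add_smul, add_assoc]

/-- Moving x by s in the direction `e` adds the integral over [0, s], so this is the fundamental
theorem of calculus on the line. -/
lemma fderiv_rayIntegral {f : E → ℝ} (hf : ContDiff ℝ ∞ f) (hc : HasCompactSupport f) {e : E}
    (he : e ≠ 0) (x : E) : fderiv ℝ (rayIntegral e f) x e = f x := by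
  have hd : DifferentiableAt ℝ (rayIntegral e f) x :=
    (contDiff_rayIntegral hf hc he).contDiffAt.differentiableAt (by simp)
  rw [← hd.lineDeriv_eq_fderiv, lineDeriv]
  have hi := integrable_comp_add_smul hf.continuous hc he x
  have hcont : Continuous fun t : ℝ => f (x + t • e) := hf.continuous.comp (by fun_prop)
  have h : ∀ s : ℝ, rayIntegral e f (x + s • e)
      = rayIntegral e f x + ∫ t in (0 : ℝ)..s, f (x + t • e) := by
    intro s
    rw [rayIntegral_add_smul, ← intervalIntegral.integral_Iic_sub_Iic hi.integrableOn
      hi.integrableOn, rayIntegral]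
    ring
  simp_rw [h]
  have := (hcont.integral_hasStrictDerivAt 0 0).hasDerivAt.const_add (rayIntegral e f x)
  simpa using this.deriv

lemma rayIntegral_eq_lineIntegral_sub {f : E → ℝ} (hf : Continuous f) (hc : HasCompactSupport f)
    {e : E} (he : e ≠ 0) (x : E) :
    rayIntegral e f x = lineIntegral e f x - ∫ t in Set.Ioi (0 : ℝ), f (x + t • e) := by
  have hi := integrable_comp_add_smul hf hc he x
  rw [lineIntegral, rayIntegral, ← intervalIntegral.integral_Iic_add_Ioi hi.integrableOn
    hi.integrableOn (b := 0)]
  ring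

end LineIntegrals

/-! ### Test functions on the square and L² bounds through line integrals -/

/-- Cauchy–Schwarz on an interval of length 2, read off from the nonnegative variance of |g| about
its mean m/2. -/
lemma sq_setIntegral_abs_le {g : ℝ → ℝ} (hg : Continuous g) :
    (∫ t in Set.Icc (-1 : ℝ) 1, |g t|) ^ 2 ≤ 2 * ∫ t in Set.Icc (-1 : ℝ) 1, g t ^ 2 := by
  set m := ∫ t in Set.Icc (-1 : ℝ) 1, |g t| with hm
  have h1 : IntegrableOn (fun t => g t ^ 2) (Set.Icc (-1 : ℝ) 1) :=
    (hg.pow 2).continuousOn.integrableOn_Icc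
  have h2 : IntegrableOn (fun t => |g t|) (Set.Icc (-1 : ℝ) 1) :=
    hg.abs.continuousOn.integrableOn_Icc
  have h0 : 0 ≤ ∫ t in Set.Icc (-1 : ℝ) 1, (|g t| - m / 2) ^ 2 :=
    integral_nonneg fun t => sq_nonneg _
  have h3 : ∫ t in Set.Icc (-1 : ℝ) 1, (|g t| - m / 2) ^ 2
      = ∫ t in Set.Icc (-1 : ℝ) 1, (g t ^ 2 - m * |g t| + (m / 2) ^ 2) := by
    congr 1 with t
    rw [← sq_abs (g t)]
    ring
  have h4 : IntegrableOn (fun t => g t ^ 2 - m * |g t|) (Set.Icc (-1 : ℝ) 1) :=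
    h1.sub (h2.const_mul m)
  rw [h3, integral_add h4 (by simp), integral_sub h1 (h2.const_mul m), integral_const_mul, ← hm,
    setIntegral_const] at h0
  norm_num at h0
  nlinarith

lemma isOpen_unitSquare : IsOpen unitSquare := by
  have : unitSquare = ⋂ i : Fin 2, {x : Plane | x i ∈ Set.Ioo (0 : ℝ) 1} := by
    ext x
    simp [unitSquare]
  rw [this]
  exact isOpen_iInter_of_finite fun i => isOpen_Ioo.preimage (by fun_prop)

/-- The `i`-th standard basis vector of the plane. -/
def basisVec (i : Fin 2) : Plane := EuclideanSpace.single i 1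

lemma basisVec_ne_zero (i : Fin 2) : basisVec i ≠ 0 := by
  simp [basisVec]

lemma add_smul_basisVec_self (x : Plane) (t : ℝ) (i : Fin 2) :
    (x + t • basisVec i) i = x i + t := by
  simp [basisVec]

lemma add_smul_basisVec_of_ne (x : Plane) (t : ℝ) {i j : Fin 2} (h : j ≠ i) :
    (x + t • basisVec i) j = x j := by
  simp [basisVec, h]

lemma IsTestFunction.eq_zero {Ω : Set Plane} {f : Plane → ℝ} (h : IsTestFunction Ω f) {x : Plane}
    (hx : x ∉ Ω) : f x = 0 :=
  image_eq_zero_of_notMem_tsupport fun hh => hx (h.tsupport_subset hh)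

/-- Compact support in the square, expressed coordinatewise. In this form, and with the converse
`isTestFunction_of_margin`, supports can be followed through integration along axes. -/
lemma IsTestFunction.exists_margin {f : Plane → ℝ} (h : IsTestFunction unitSquare f) :
    ∃ δ : ℝ, 0 < δ ∧ ∀ x, f x ≠ 0 → ∀ i, x i ∈ Set.Icc δ (1 - δ) := by
  obtain ⟨δ, hδ, hs⟩ := h.hasCompactSupport.isCompact.exists_cthickening_subset_open
    isOpen_unitSquare h.tsupport_subset
  refine ⟨δ, hδ, fun x hx i => ?_⟩
  have hmem : ∀ s : ℝ, |s| ≤ δ → x + s • basisVec i ∈ unitSquare := by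
    intro s hs'
    refine hs (Metric.mem_cthickening_of_dist_le _ x _ _ (subset_tsupport _ hx) ?_)
    simpa [basisVec, dist_eq_norm, norm_smul] using hs'
  have h1 := hmem δ (abs_of_pos hδ).le i
  have h2 := hmem (-δ) (by rw [abs_neg]; exact (abs_of_pos hδ).le) i
  rw [add_smul_basisVec_self] at h1 h2
  exact ⟨by linarith [h2.1], by linarith [h1.2]⟩

lemma isTestFunction_of_margin {f : Plane → ℝ} (hf : ContDiff ℝ ∞ f) {δ : ℝ} (hδ : 0 < δ)
    (h : ∀ x, f x ≠ 0 → ∀ i, x i ∈ Set.Icc δ (1 - δ)) : IsTestFunction unitSquare f := by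
  set K : Set Plane := (EuclideanSpace.equiv (Fin 2) ℝ) ⁻¹'
    Set.pi Set.univ fun _ => Set.Icc δ (1 - δ) with hK
  have hKc : IsCompact K :=
    (EuclideanSpace.equiv (Fin 2) ℝ).toHomeomorph.isCompact_preimage.mpr
      (isCompact_univ_pi fun _ => isCompact_Icc)
  have hsub : Function.support f ⊆ K := fun x hx i _ => h x hx i
  refine ⟨hf, HasCompactSupport.of_support_subset_isCompact hKc hsub, fun x hx i => ?_⟩
  have hxK := closure_minimal hsub hKc.isClosed hx
  have := hxK i trivial
  change x i ∈ Set.Icc δ (1 - δ) at this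
  exact ⟨by linarith [this.1], by linarith [this.2]⟩

/-- Cauchy–Schwarz in t, Fubini, and translation invariance of the plane integral of f², which
vanishes off the square. One factor 2 comes from Cauchy–Schwarz, the other from the length of [-1,
1]. -/
lemma integral_sq_le_of_abs_le_integral_line {e : Plane} {f w : Plane → ℝ} {C : ℝ}
    (hf : IsTestFunction unitSquare f) (hw : IsTestFunction unitSquare w)
    (h : ∀ x ∈ unitSquare, |w x| ≤ C * ∫ t in Set.Icc (-1 : ℝ) 1, |f (x + t • e)|) :
    ∫ x in unitSquare, w x ^ 2 ≤ 4 * C ^ 2 * ∫ x in unitSquare, f x ^ 2 := by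
  have hfc := hf.contDiff.continuous
  have hcont : Continuous fun p : Plane × ℝ => f (p.1 + p.2 • e) := hfc.comp (by fun_prop)
  obtain ⟨M, hM⟩ := hf.hasCompactSupport.exists_bound_of_continuous hfc
  have hprod : Integrable (fun p : Plane × ℝ => f (p.1 + p.2 • e) ^ 2)
      ((volume.restrict unitSquare).prod (volume.restrict (Set.Icc (-1 : ℝ) 1))) := by
    refine Integrable.of_bound (hcont.pow 2).aestronglyMeasurable (M ^ 2)
      (Filter.Eventually.of_forall fun p => ?_)
    rw [norm_pow]
    exact pow_le_pow_left₀ (norm_nonneg _) (hM _) 2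
  have hcs : HasCompactSupport fun x => f x ^ 2 :=
    hf.hasCompactSupport.mono fun x hx hz => hx (by simp [hz])
  have hsq : Integrable (fun x => f x ^ 2) := (hfc.pow 2).integrable_of_hasCompactSupport hcs
  have hpt : ∀ x ∈ unitSquare,
      w x ^ 2 ≤ C ^ 2 * (2 * ∫ t in Set.Icc (-1 : ℝ) 1, f (x + t • e) ^ 2) := by
    intro x hx
    rw [← sq_abs (w x)]
    refine (pow_le_pow_left₀ (abs_nonneg _) (h x hx) 2).trans ?_
    rw [mul_pow]
    gcongr
    exact sq_setIntegral_abs_le (hfc.comp (by fun_prop))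
  have htr : ∀ t : ℝ, ∫ x in unitSquare, f (x + t • e) ^ 2 ≤ ∫ x in unitSquare, f x ^ 2 := by
    intro t
    calc ∫ x in unitSquare, f (x + t • e) ^ 2 ≤ ∫ x, f (x + t • e) ^ 2 :=
          setIntegral_le_integral (hsq.comp_add_right (t • e))
            (Filter.Eventually.of_forall fun x => sq_nonneg _)
      _ = ∫ x, f x ^ 2 := integral_add_right_eq_self (fun x => f x ^ 2) (t • e)
      _ = ∫ x in unitSquare, f x ^ 2 :=
          (setIntegral_eq_integral_of_forall_compl_eq_zero fun x hx => by
            rw [hf.eq_zero hx]; norm_num).symm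
  calc ∫ x in unitSquare, w x ^ 2
      ≤ ∫ x in unitSquare, C ^ 2 * (2 * ∫ t in Set.Icc (-1 : ℝ) 1, f (x + t • e) ^ 2) := by
        refine setIntegral_mono_on hw.memLp.integrable_sq
          ((hprod.integral_prod_left.const_mul 2).const_mul (C ^ 2))
          isOpen_unitSquare.measurableSet hpt
    _ = C ^ 2 * (2 * ∫ t in Set.Icc (-1 : ℝ) 1, ∫ x in unitSquare, f (x + t • e) ^ 2) := by
        rw [integral_const_mul, integral_const_mul, integral_integral_swap hprod]
    _ ≤ C ^ 2 * (2 * ∫ t in Set.Icc (-1 : ℝ) 1, ∫ x in unitSquare, f x ^ 2) := by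
        have hle : ∫ t in Set.Icc (-1 : ℝ) 1, ∫ x in unitSquare, f (x + t • e) ^ 2
            ≤ ∫ t in Set.Icc (-1 : ℝ) 1, ∫ x in unitSquare, f x ^ 2 :=
          integral_mono hprod.integral_prod_right (integrable_const _) htr
        exact mul_le_mul_of_nonneg_left (mul_le_mul_of_nonneg_left hle zero_le_two) (sq_nonneg C)
    _ = 4 * C ^ 2 * ∫ x in unitSquare, f x ^ 2 := by
        rw [setIntegral_const]
        norm_num
        ring

lemma IsTestFunction.sub {Ω : Set Plane} {f g : Plane → ℝ} (hf : IsTestFunction Ω f)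
    (hg : IsTestFunction Ω g) : IsTestFunction Ω (fun x => f x - g x) where
  contDiff := hf.contDiff.sub hg.contDiff
  hasCompactSupport := hf.hasCompactSupport.sub hg.hasCompactSupport
  tsupport_subset := (tsupport_sub f g).trans
    (Set.union_subset hf.tsupport_subset hg.tsupport_subset)

/-- A bump function on `(0,1)` with integral one. -/
def bump : ContDiffBump (1 / 2 : ℝ) := ⟨1 / 8, 1 / 4, by norm_num, by norm_num⟩

/-- A smooth nonnegative function of integral one, supported in `[1/4, 3/4]`. -/
def eta : ℝ → ℝ := bump.normed volume

lemma contDiff_eta : ContDiff ℝ ∞ eta := bump.contDiff_normed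

lemma eta_nonneg (t : ℝ) : 0 ≤ eta t := bump.nonneg_normed t

lemma integral_eta : ∫ t, eta t = 1 := bump.integral_normed

lemma eta_half_pos : 0 < eta (1 / 2) := by
  have : (1 / 2 : ℝ) ∈ Function.support eta := by
    rw [eta, ContDiffBump.support_normed_eq]
    simp [bump]
  exact lt_of_le_of_ne (eta_nonneg _) (Ne.symm this)

lemma mem_Icc_of_eta_ne_zero {t : ℝ} (h : eta t ≠ 0) : t ∈ Set.Icc (1 / 4 : ℝ) (1 - 1 / 4) := by
  have : t ∈ Function.support eta := h
  rw [eta, ContDiffBump.support_normed_eq, Metric.mem_ball, Real.dist_eq, abs_lt] at this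
  change -(1 / 4 : ℝ) < _ ∧ _ < (1 / 4 : ℝ) at this
  constructor <;> linarith [this.1, this.2]

lemma exists_eta_le : ∃ M : ℝ, 0 ≤ M ∧ ∀ t, eta t ≤ M := by
  obtain ⟨M, hM⟩ := bump.hasCompactSupport_normed (μ := volume).exists_bound_of_continuous
    contDiff_eta.continuous
  exact ⟨M, (norm_nonneg _).trans (hM 0), fun t => (Real.le_norm_self _).trans (hM t)⟩

/-! ### Splitting a test function into partial derivatives and a multiple of a fixed bump -/

section TestFunctionOperators

/-- The operator `f ↦ η(xᵢ) ∫ f dxᵢ`. -/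
def avgOp (i : Fin 2) (f : Plane → ℝ) (x : Plane) : ℝ :=
  eta (x i) * lineIntegral (basisVec i) f x

/-- The primitive in direction `i` of `f - avgOp i f`. -/
def primOp (i : Fin 2) (f : Plane → ℝ) : Plane → ℝ :=
  rayIntegral (basisVec i) fun x => f x - avgOp i f x

variable {f : Plane → ℝ}

/-- In direction i the margin 1/4 comes from `eta`. In the other direction the line integral is
nonzero only if the line meets the support of f, so the margin of f is inherited. -/
lemma IsTestFunction.avgOp (hf : IsTestFunction unitSquare f) (i : Fin 2) :
    IsTestFunction unitSquare (avgOp i f) := by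
  obtain ⟨δ, hδ, h⟩ := hf.exists_margin
  have hs : ContDiff ℝ ∞ (CahnHilliard.avgOp i f) := by
    refine ContDiff.mul (contDiff_eta.comp ?_)
      (contDiff_lineIntegral hf.contDiff hf.hasCompactSupport (basisVec_ne_zero i))
    exact (EuclideanSpace.proj i : Plane →L[ℝ] ℝ).contDiff
  refine isTestFunction_of_margin hs (δ := min δ (1 / 4)) (by positivity) fun x hx j => ?_
  by_cases hj : j = i
  · subst hj
    have h1 := mem_Icc_of_eta_ne_zero (left_ne_zero_of_mul hx)
    have h2 := min_le_right δ (1 / 4)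
    exact ⟨h2.trans h1.1, by linarith [h1.2]⟩
  · have h1 : ∃ t : ℝ, f (x + t • basisVec i) ≠ 0 := by
      by_contra! h0
      refine right_ne_zero_of_mul hx ?_
      simp [lineIntegral, h0]
    obtain ⟨t, ht⟩ := h1
    have h3 := h _ ht j
    rw [add_smul_basisVec_of_ne _ _ hj] at h3
    have h2 := min_le_left δ (1 / 4)
    exact ⟨h2.trans h3.1, by linarith [h3.2]⟩

lemma lineIntegral_eta_mul (i : Fin 2) (x : Plane) (c : Plane → ℝ)
    (hc : ∀ (y : Plane) (t : ℝ), c (y + t • basisVec i) = c y) :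
    lineIntegral (basisVec i) (fun y => eta (y i) * c y) x = c x := by
  simp only [lineIntegral, hc, add_smul_basisVec_self]
  rw [integral_mul_const, integral_add_left_eq_self eta (x i), integral_eta, one_mul]

lemma lineIntegral_sub_avgOp (hf : IsTestFunction unitSquare f) (i : Fin 2) (x : Plane) :
    lineIntegral (basisVec i) (fun y => f y - avgOp i f y) x = 0 := by
  have h1 : lineIntegral (basisVec i) (avgOp i f) x = lineIntegral (basisVec i) f x :=
    lineIntegral_eta_mul i x (lineIntegral (basisVec i) f)
      fun y t => lineIntegral_add_smul _ _ _ _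
  have he := basisVec_ne_zero i
  have h2 : lineIntegral (basisVec i) (fun y => f y - avgOp i f y) x
      = lineIntegral (basisVec i) f x - lineIntegral (basisVec i) (avgOp i f) x :=
    integral_sub
      (integrable_comp_add_smul hf.contDiff.continuous hf.hasCompactSupport he x)
      (integrable_comp_add_smul (hf.avgOp i).contDiff.continuous (hf.avgOp i).hasCompactSupport he x)
  rw [h2, h1, sub_self]

/-- As the full line integral vanishes, the ray integral is also minus the integral over the
opposite ray. Where it is nonzero, f is therefore nonzero both behind and ahead of x, which traps x
between points of the support. -/
lemma isTestFunction_rayIntegral (hf : IsTestFunction unitSquare f) (i : Fin 2)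
    (h0 : ∀ x, lineIntegral (basisVec i) f x = 0) :
    IsTestFunction unitSquare (rayIntegral (basisVec i) f) := by
  obtain ⟨δ, hδ, h⟩ := hf.exists_margin
  have he := basisVec_ne_zero i
  refine isTestFunction_of_margin (contDiff_rayIntegral hf.contDiff hf.hasCompactSupport he) hδ
    fun x hx j => ?_
  have h1 : ∃ t ≤ (0 : ℝ), f (x + t • basisVec i) ≠ 0 := by
    by_contra! hz
    exact hx (setIntegral_eq_zero_of_forall_eq_zero fun t ht => hz t ht)
  have h2 : ∃ t > (0 : ℝ), f (x + t • basisVec i) ≠ 0 := by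
    by_contra! hz
    refine hx ?_
    have hI : ∫ t in Set.Ioi (0 : ℝ), f (x + t • basisVec i) = 0 :=
      setIntegral_eq_zero_of_forall_eq_zero fun t ht => hz t ht
    rw [rayIntegral_eq_lineIntegral_sub hf.contDiff.continuous hf.hasCompactSupport he, h0, hI,
      sub_zero]
  obtain ⟨t, ht, hft⟩ := h1
  obtain ⟨s, hs, hfs⟩ := h2
  have h3 := h _ hft j
  have h4 := h _ hfs j
  by_cases hj : j = i
  · subst hj
    rw [add_smul_basisVec_self] at h3 h4
    exact ⟨by linarith [h3.1], by linarith [h4.2]⟩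
  · rwa [add_smul_basisVec_of_ne _ _ hj] at h3

lemma IsTestFunction.primOp (hf : IsTestFunction unitSquare f) (i : Fin 2) :
    IsTestFunction unitSquare (primOp i f) :=
  isTestFunction_rayIntegral (hf.sub (hf.avgOp i)) i (lineIntegral_sub_avgOp hf i)

lemma partialDeriv_primOp (hf : IsTestFunction unitSquare f) (i : Fin 2) (x : Plane) :
    partialDeriv i (primOp i f) x = f x - avgOp i f x :=
  have h := hf.sub (hf.avgOp i)
  fderiv_rayIntegral h.contDiff h.hasCompactSupport (basisVec_ne_zero i) x

/-- The square has width 1, so a shift by more than 1 leaves it; this is why the window [-1, 1]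
suffices. -/
lemma IsTestFunction.eq_zero_of_notMem_Icc (hf : IsTestFunction unitSquare f) {x : Plane}
    (hx : x ∈ unitSquare) (i : Fin 2) {t : ℝ} (ht : t ∉ Set.Icc (-1 : ℝ) 1) :
    f (x + t • basisVec i) = 0 := by
  refine hf.eq_zero fun h => ht ?_
  have h1 := h i
  have h2 := hx i
  rw [add_smul_basisVec_self] at h1
  exact ⟨by linarith [h1.1, h2.2], by linarith [h1.2, h2.1]⟩

lemma IsTestFunction.integral_abs_eq (hf : IsTestFunction unitSquare f) {x : Plane}
    (hx : x ∈ unitSquare) (i : Fin 2) :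
    ∫ t in Set.Icc (-1 : ℝ) 1, |f (x + t • basisVec i)| = ∫ t : ℝ, |f (x + t • basisVec i)| :=
  setIntegral_eq_integral_of_forall_compl_eq_zero fun t ht => by
    rw [hf.eq_zero_of_notMem_Icc hx i ht, abs_zero]

lemma exists_integral_sq_avgOp_le : ∃ C : ℝ, 0 ≤ C ∧ ∀ f, IsTestFunction unitSquare f → ∀ i,
    ∫ x in unitSquare, avgOp i f x ^ 2 ≤ C * ∫ x in unitSquare, f x ^ 2 := by
  obtain ⟨M, hM, hle⟩ := exists_eta_le
  refine ⟨4 * M ^ 2, by positivity, fun f hf i => ?_⟩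
  refine integral_sq_le_of_abs_le_integral_line (e := basisVec i) hf (hf.avgOp i) fun x hx => ?_
  rw [hf.integral_abs_eq hx, CahnHilliard.avgOp, abs_mul, abs_of_nonneg (eta_nonneg _)]
  exact mul_le_mul (hle _) (abs_integral_le_integral_abs) (abs_nonneg _) hM

lemma exists_integral_sq_primOp_le : ∃ C : ℝ, 0 ≤ C ∧ ∀ f, IsTestFunction unitSquare f → ∀ i,
    ∫ x in unitSquare, primOp i f x ^ 2 ≤ C * ∫ x in unitSquare, f x ^ 2 := by
  obtain ⟨C, hC, hle⟩ := exists_integral_sq_avgOp_le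
  -- The 4 comes from the line estimate with constant 1, and 2 + 2C from (f − Af)² ≤ 2f² + 2(Af)².
  refine ⟨4 * (2 + 2 * C), by positivity, fun f hf i => ?_⟩
  have hd := hf.sub (hf.avgOp i)
  have h1 := integral_sq_le_of_abs_le_integral_line (e := basisVec i) (C := 1) hd (hf.primOp i)
    fun x hx => by
      rw [hd.integral_abs_eq hx, one_mul]
      refine (abs_integral_le_integral_abs).trans ?_
      exact setIntegral_le_integral
        (integrable_comp_add_smul hd.contDiff.continuous hd.hasCompactSupport
          (basisVec_ne_zero i) x).abs (Filter.Eventually.of_forall fun t => abs_nonneg _)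
  have i1 := hf.memLp.integrable_sq
  have i2 := (hf.avgOp i).memLp.integrable_sq
  have h2 : ∫ x in unitSquare, (f x - avgOp i f x) ^ 2
      ≤ ∫ x in unitSquare, (2 * f x ^ 2 + 2 * avgOp i f x ^ 2) := by
    refine integral_mono hd.memLp.integrable_sq ((i1.const_mul 2).add (i2.const_mul 2)) fun x => ?_
    change _ ≤ 2 * f x ^ 2 + 2 * avgOp i f x ^ 2
    nlinarith [sq_nonneg (f x + avgOp i f x)]
  rw [integral_add (i1.const_mul 2) (i2.const_mul 2), integral_const_mul, integral_const_mul] at h2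
  have h3 := hle f hf i
  linarith

/-- The function `η(x₀) η(x₁)`. -/
def eta₂ (x : Plane) : ℝ := eta (x 0) * eta (x 1)

/-- The iterated line integral is invariant under translation along both axes, hence constant; only
the two bump factors depend on x. -/
lemma exists_avgOp_avgOp_eq (f : Plane → ℝ) : ∃ c : ℝ, ∀ x, avgOp 0 (avgOp 1 f) x = c * eta₂ x := by
  set L : Plane → ℝ := lineIntegral (basisVec 0) (lineIntegral (basisVec 1) f) with hL
  have h0 : ∀ (y : Plane) (t : ℝ), L (y + t • basisVec 0) = L y := fun y t =>
    lineIntegral_add_smul _ _ _ _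
  have h1 : ∀ (y : Plane) (t : ℝ), L (y + t • basisVec 1) = L y := by
    intro y t
    simp only [hL, lineIntegral]
    congr 1 with s
    have := lineIntegral_add_smul (basisVec 1) f (y + s • basisVec 0) t
    rw [add_right_comm] at this
    exact this
  have hconst : ∀ x, L x = L 0 := by
    intro x
    have hx : x = 0 + x 0 • basisVec 0 + x 1 • basisVec 1 := by
      ext i
      fin_cases i <;> simp [basisVec]
    rw [hx, h1, h0]
  refine ⟨L 0, fun x => ?_⟩
  have h2 : lineIntegral (basisVec 0) (avgOp 1 f) x = eta (x 1) * L x := by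
    simp only [hL, lineIntegral, avgOp, add_smul_basisVec_of_ne _ _ (one_ne_zero : (1 : Fin 2) ≠ 0)]
    rw [integral_const_mul]
  rw [avgOp, h2, hconst, eta₂]
  ring

lemma isTestFunction_eta₂ : IsTestFunction unitSquare eta₂ := by
  refine isTestFunction_of_margin (ContDiff.mul (contDiff_eta.comp
    (EuclideanSpace.proj 0 : Plane →L[ℝ] ℝ).contDiff) (contDiff_eta.comp
    (EuclideanSpace.proj 1 : Plane →L[ℝ] ℝ).contDiff)) (δ := 1 / 4) (by norm_num) fun x hx i => ?_
  fin_cases i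
  · exact mem_Icc_of_eta_ne_zero (left_ne_zero_of_mul hx)
  · exact mem_Icc_of_eta_ne_zero (right_ne_zero_of_mul hx)

lemma integral_eta₂_pos : 0 < ∫ x in unitSquare, eta₂ x := by
  have h := isTestFunction_eta₂
  rw [setIntegral_eq_integral_of_forall_compl_eq_zero fun x hx => h.eq_zero hx]
  refine h.contDiff.continuous.integral_pos_of_hasCompactSupport_nonneg_nonzero
    h.hasCompactSupport (fun x => mul_nonneg (eta_nonneg _) (eta_nonneg _))
    (x := WithLp.toLp 2 fun _ => 1 / 2) ?_
  exact (mul_pos eta_half_pos eta_half_pos).ne'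

end TestFunctionOperators

/-! ### L² pairings and the dual estimate -/

lemma inner_toLp_right {Ω : Set Plane} (u : L2 Ω) {f : Plane → ℝ}
    (hf : MemLp f 2 (volume.restrict Ω)) : inner ℝ u (hf.toLp f) = ∫ x in Ω, u x * f x := by
  rw [L2.inner_def]
  refine integral_congr_ae ?_
  filter_upwards [hf.coeFn_toLp] with x hx
  rw [hx, RCLike.inner_apply, conj_trivial, mul_comm]

lemma norm_sq_toLp {Ω : Set Plane} {f : Plane → ℝ} (hf : MemLp f 2 (volume.restrict Ω)) :
    ‖hf.toLp f‖ ^ 2 = ∫ x in Ω, f x ^ 2 := by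
  rw [← real_inner_self_eq_norm_sq, inner_toLp_right]
  refine integral_congr_ae ?_
  filter_upwards [hf.coeFn_toLp] with x hx
  rw [hx, sq]

lemma norm_toLp_le_of_integral_sq_le {Ω : Set Plane} {f g : Plane → ℝ}
    (hf : MemLp f 2 (volume.restrict Ω)) (hg : MemLp g 2 (volume.restrict Ω)) {C : ℝ} (hC : 0 ≤ C)
    (h : ∫ x in Ω, f x ^ 2 ≤ C * ∫ x in Ω, g x ^ 2) :
    ‖hf.toLp f‖ ≤ Real.sqrt C * ‖hg.toLp g‖ := by
  rw [← norm_sq_toLp hf, ← norm_sq_toLp hg] at h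
  refine abs_le_of_sq_le_sq' ?_ (by positivity) |>.2
  rwa [mul_pow, Real.sq_sqrt hC]

lemma abs_integral_coord_mul_le {Ω : Set Plane} (g : L2Vec Ω) (i : Fin 2) {f : Plane → ℝ}
    (hf : MemLp f 2 (volume.restrict Ω)) :
    |∫ x in Ω, g x i * f x| ≤ ‖g‖ * ‖hf.toLp f‖ := by
  have h1 : ∫ x in Ω, g x i * f x = inner ℝ ((memLp_coord g i).toLp _) (hf.toLp f) := by
    rw [inner_toLp_right]
    refine integral_congr_ae ?_
    filter_upwards [(memLp_coord g i).coeFn_toLp] with x hx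
    rw [hx]
  have h2 : ‖(memLp_coord g i).toLp _‖ ≤ ‖g‖ := by
    refine Lp.norm_le_norm_of_ae_le ?_
    filter_upwards [(memLp_coord g i).coeFn_toLp] with x hx
    rw [hx]
    exact PiLp.norm_apply_le (g x) i
  rw [h1]
  exact (abs_real_inner_le_norm _ _).trans (mul_le_mul_of_nonneg_right h2 (norm_nonneg _))

/-- Dual form of Poincaré–Wirtinger: the splitting is applied first in direction 1, then in
direction 0, and the weak gradient absorbs both derivatives. It matters that c depends on f alone,
so that it can later be computed by taking u = 1. -/
lemma exists_abs_integral_sub_le : ∃ C : ℝ, 0 ≤ C ∧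
    ∀ (f : Plane → ℝ) (hf : IsTestFunction unitSquare f), ∃ c : ℝ, ∀ u : H1 unitSquare,
      |(∫ x in unitSquare, H1.val u x * f x) - c * ∫ x in unitSquare, H1.val u x * eta₂ x|
        ≤ C * ‖H1.grad u‖ * ‖hf.memLp.toLp f‖ := by
  obtain ⟨A, hA, hAle⟩ := exists_integral_sq_avgOp_le
  obtain ⟨B, hB, hBle⟩ := exists_integral_sq_primOp_le
  refine ⟨√B + √B * √A, by positivity, fun f hf => ?_⟩
  obtain ⟨c, hc⟩ := exists_avgOp_avgOp_eq f
  refine ⟨c, fun u => ?_⟩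
  have hp := hf.avgOp 1
  have hi : ∀ {g}, IsTestFunction unitSquare g → Integrable (fun x => H1.val u x * g x)
      (volume.restrict unitSquare) := fun hg => (Lp.memLp (H1.val u)).integrable_mul hg.memLp
  have key : ∀ {g} (_ : IsTestFunction unitSquare g) (i : Fin 2),
      (∫ x in unitSquare, H1.val u x * g x) - ∫ x in unitSquare, H1.val u x * avgOp i g x
        = -∫ x in unitSquare, H1.grad u x i * primOp i g x := by
    intro g hg i
    rw [← integral_sub (hi hg) (hi (hg.avgOp i))]
    refine Eq.trans ?_ (u.2 _ (hg.primOp i) i)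
    congr 1 with x
    rw [partialDeriv_primOp hg, mul_sub]
    rfl
  have e1 := key hf 1
  have e2 := key hp 0
  have e3 : ∫ x in unitSquare, H1.val u x * avgOp 0 (avgOp 1 f) x
      = c * ∫ x in unitSquare, H1.val u x * eta₂ x := by
    rw [← integral_const_mul]
    congr 1 with x
    rw [hc]
    ring
  have b1 := abs_integral_coord_mul_le (H1.grad u) 1 (hf.primOp 1).memLp
  have b2 := abs_integral_coord_mul_le (H1.grad u) 0 (hp.primOp 0).memLp
  have n1 := norm_toLp_le_of_integral_sq_le (hf.primOp 1).memLp hf.memLp hB (hBle f hf 1)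
  have n2 := norm_toLp_le_of_integral_sq_le (hp.primOp 0).memLp hp.memLp hB (hBle _ hp 0)
  have n3 := norm_toLp_le_of_integral_sq_le hp.memLp hf.memLp hA (hAle f hf 1)
  have hsum : (∫ x in unitSquare, H1.val u x * f x) - c * ∫ x in unitSquare, H1.val u x * eta₂ x
      = -(∫ x in unitSquare, H1.grad u x 1 * primOp 1 f x)
        - ∫ x in unitSquare, H1.grad u x 0 * primOp 0 (avgOp 1 f) x := by
    linarith
  rw [hsum]
  refine (abs_sub _ _).trans ?_
  rw [abs_neg]
  have m1 := b1.trans (mul_le_mul_of_nonneg_left n1 (norm_nonneg _))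
  have m2 := b2.trans (mul_le_mul_of_nonneg_left (n2.trans
    (mul_le_mul_of_nonneg_left n3 (Real.sqrt_nonneg _))) (norm_nonneg _))
  calc _ ≤ _ := add_le_add m1 m2
    _ = _ := by ring

/-! ### Constants, density of test functions, Poincaré–Wirtinger and Friedrichs inequalities -/

/-- Integration by parts against the constant 1; it shows that 1 has weak gradient zero. -/
lemma integral_partialDeriv_eq_zero {Ω : Set Plane} {φ : Plane → ℝ} (h : IsTestFunction Ω φ)
    (i : Fin 2) : ∫ x in Ω, partialDeriv i φ x = 0 := by
  have hd : Differentiable ℝ φ := h.contDiff.differentiable (by simp)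
  have hc : Continuous (partialDeriv i φ) :=
    (h.contDiff.continuous_fderiv (by simp)).clm_apply continuous_const
  have hcs : HasCompactSupport (partialDeriv i φ) := h.hasCompactSupport.fderiv_apply ℝ _
  rw [setIntegral_eq_integral_of_forall_compl_eq_zero fun x hx => by
    refine image_eq_zero_of_notMem_tsupport fun hh => hx (h.tsupport_subset ?_)
    exact tsupport_fderiv_apply_subset ℝ _ hh]
  have := integral_bilinear_hasFDerivAt_right_eq_neg_left_of_integrable
    (μ := (volume : Measure Plane)) (f := fun _ : Plane => (1 : ℝ)) (f' := fun _ => 0) (g := φ)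
    (g' := fderiv ℝ φ) (v := EuclideanSpace.single i 1) (B := ContinuousLinearMap.mul ℝ ℝ)
    (by simp)
    (by simp only [ContinuousLinearMap.mul_apply', one_mul]
        exact hc.integrable_of_hasCompactSupport hcs)
    (by simpa using h.contDiff.continuous.integrable_of_hasCompactSupport h.hasCompactSupport)
    (fun x _ => hasFDerivAt_const _ _) (fun x _ => (hd x).hasFDerivAt)
  simp only [ContinuousLinearMap.mul_apply', one_mul, zero_apply, zero_mul,
    integral_zero, neg_zero] at this
  exact this

/-- The constant function one as an element of `H¹(Ω)`. -/
def H1.one : H1 unitSquare :=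
  ⟨WithLp.toLp 2 ((memLp_const (1 : ℝ)).toLp (fun _ : Plane => (1 : ℝ)), 0), by
    intro φ h i
    have h1 : ∫ x in unitSquare, (memLp_const (1 : ℝ)).toLp (p := 2)
        (μ := volume.restrict unitSquare) (fun _ : Plane => (1 : ℝ)) x * partialDeriv i φ x
        = ∫ x in unitSquare, partialDeriv i φ x := by
      refine integral_congr_ae ?_
      filter_upwards [(memLp_const (1 : ℝ)).coeFn_toLp (p := 2)
        (μ := volume.restrict unitSquare)] with x hx
      rw [hx, one_mul]
    have h2 : ∫ x in unitSquare, (0 : L2Vec unitSquare) x i * φ x = ∫ x in unitSquare, (0 : ℝ) := by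
      refine integral_congr_ae ?_
      filter_upwards [Lp.coeFn_zero Plane 2 (volume.restrict unitSquare)] with x hx
      rw [hx, Pi.zero_apply, PiLp.zero_apply, zero_mul]
    refine h1.trans ((integral_partialDeriv_eq_zero h i).trans ?_)
    refine Eq.trans ?_ (congrArg Neg.neg h2.symm)
    simp⟩

lemma H1.val_one : H1.val H1.one = (memLp_const (1 : ℝ)).toLp (fun _ : Plane => (1 : ℝ)) := rfl

lemma H1.val_one_ae : H1.val H1.one =ᵐ[volume.restrict unitSquare] fun _ => (1 : ℝ) :=
  (memLp_const (1 : ℝ)).coeFn_toLp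

lemma H1.grad_one : H1.grad H1.one = 0 := rfl

lemma H1.norm_sq_eq (u : H1 unitSquare) : ‖u‖ ^ 2 = ‖H1.val u‖ ^ 2 + ‖H1.grad u‖ ^ 2 := by
  rw [← real_inner_self_eq_norm_sq, H1.inner_eq, real_inner_self_eq_norm_sq,
    real_inner_self_eq_norm_sq]

lemma H1.norm_val_le (u : H1 unitSquare) : ‖H1.val u‖ ≤ ‖u‖ :=
  abs_le_of_sq_le_sq' (by nlinarith [H1.norm_sq_eq u, sq_nonneg ‖H1.grad u‖]) (norm_nonneg _) |>.2

lemma H1.norm_grad_le (u : H1 unitSquare) : ‖H1.grad u‖ ≤ ‖u‖ :=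
  abs_le_of_sq_le_sq' (by nlinarith [H1.norm_sq_eq u, sq_nonneg ‖H1.val u‖]) (norm_nonneg _) |>.2

/-- Test functions are dense in `L²`: bounds on pairings with test functions bound the norm. -/
lemma norm_le_of_forall_testFunction {Ω : Set Plane} (hΩ : IsOpen Ω) (v : L2 Ω) {K : ℝ} (hK : 0 ≤ K)
    (h : ∀ (f : Plane → ℝ) (hf : IsTestFunction Ω f),
      inner ℝ v (hf.memLp.toLp f) ≤ K * ‖hf.memLp.toLp f‖) : ‖v‖ ≤ K := by
  let S : Submodule ℝ (L2 Ω) :=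
    { carrier := {w | ∃ (f : Plane → ℝ) (hf : IsTestFunction Ω f), w = hf.memLp.toLp f}
      add_mem' := by
        rintro _ _ ⟨f, hf, rfl⟩ ⟨g, hg, rfl⟩
        exact ⟨f + g, ⟨hf.contDiff.add hg.contDiff, hf.hasCompactSupport.add hg.hasCompactSupport,
          (tsupport_add f g).trans (Set.union_subset hf.tsupport_subset hg.tsupport_subset)⟩, rfl⟩
      zero_mem' := ⟨0, ⟨contDiff_const, HasCompactSupport.zero, by simp⟩, rfl⟩
      smul_mem' := by
        rintro r _ ⟨f, hf, rfl⟩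
        exact ⟨r • f, ⟨contDiff_const.smul hf.contDiff, hf.hasCompactSupport.smul_left,
          (tsupport_smul_subset_right (fun _ => r) f).trans hf.tsupport_subset⟩, rfl⟩ }
  -- A function orthogonal to all test functions vanishes almost everywhere, by the fundamental
  -- lemma of the calculus of variations.
  have hS : S.topologicalClosure = ⊤ := by
    rw [Submodule.topologicalClosure_eq_top_iff, Submodule.eq_bot_iff]
    intro w hw
    have hz : ∀ᵐ x ∂(volume : Measure Plane), x ∈ Ω → w x = 0 := by
      refine hΩ.ae_eq_zero_of_integral_contDiff_smul_eq_zero ?_ ?_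
      · rw [locallyIntegrableOn_iff hΩ.isLocallyClosed]
        intro k hk hkc
        have : IsFiniteMeasure ((volume : Measure Plane).restrict k) :=
          ⟨by simpa using hkc.measure_lt_top⟩
        exact ((Lp.memLp w).mono_measure (Measure.restrict_mono hk le_rfl)).integrable
          (by norm_num)
      · intro φ hφ hc hs
        have ht : IsTestFunction Ω φ := ⟨hφ, hc, hs⟩
        have h0 := (Submodule.mem_orthogonal' S w).mp hw _ ⟨φ, ht, rfl⟩
        rw [inner_toLp_right] at h0
        rw [← h0, ← setIntegral_eq_integral_of_forall_compl_eq_zero (s := Ω)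
          fun x hx => by rw [ht.eq_zero hx, zero_smul]]
        congr 1 with x
        rw [smul_eq_mul, mul_comm]
    refine Lp.ext ?_
    rw [Filter.EventuallyEq, ae_restrict_iff' hΩ.measurableSet]
    have h0 := (ae_restrict_iff' hΩ.measurableSet).mp (Lp.coeFn_zero ℝ 2 (volume.restrict Ω))
    filter_upwards [hz, h0] with x h1 h2 hx
    rw [h1 hx, h2 hx, Pi.zero_apply]
  have hclosed : IsClosed {w : L2 Ω | inner ℝ v w ≤ K * ‖w‖} :=
    isClosed_le (by fun_prop) (by fun_prop)
  have hv : v ∈ {w : L2 Ω | inner ℝ v w ≤ K * ‖w‖} := by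
    have hsub : (S : Set (L2 Ω)) ⊆ {w : L2 Ω | inner ℝ v w ≤ K * ‖w‖} := by
      rintro _ ⟨f, hf, rfl⟩
      exact h f hf
    refine closure_minimal hsub hclosed ?_
    rw [← Submodule.topologicalClosure_coe, hS]
    trivial
  change inner ℝ v v ≤ K * ‖v‖ at hv
  rw [real_inner_self_eq_norm_mul_norm] at hv
  rcases (norm_nonneg v).eq_or_lt with h0 | h0
  · rwa [← h0]
  · exact le_of_mul_le_mul_right hv h0

/-- The Poincaré–Wirtinger inequality on the unit square. -/
lemma exists_norm_sub_smul_one_le : ∃ C : ℝ, 0 ≤ C ∧ ∀ u : H1 unitSquare, ∃ m : ℝ,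
    ‖u - m • H1.one‖ ≤ C * ‖H1.grad u‖ := by
  obtain ⟨C, hC, h⟩ := exists_abs_integral_sub_le
  refine ⟨C + 1, by positivity, fun u => ?_⟩
  set s := ∫ x in unitSquare, eta₂ x with hs
  have hs0 : s ≠ 0 := integral_eta₂_pos.ne'
  -- The constant for which u − m pairs to zero with `eta₂`.
  set m := (∫ x in unitSquare, H1.val u x * eta₂ x) / s with hm
  have hone : ∀ g : Plane → ℝ, ∫ x in unitSquare, H1.val H1.one x * g x
      = ∫ x in unitSquare, g x := by
    intro g
    refine integral_congr_ae ?_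
    filter_upwards [H1.val_one_ae] with x hx
    rw [hx, one_mul]
  have hval : ‖H1.val u - m • H1.val H1.one‖ ≤ C * ‖H1.grad u‖ := by
    refine norm_le_of_forall_testFunction isOpen_unitSquare _ (by positivity) fun f hf => ?_
    obtain ⟨c, hc⟩ := h f hf
    -- The right-hand side vanishes for the constant 1, which forces ∫f = cs and identifies c.
    have h1 := hc H1.one
    rw [H1.grad_one, norm_zero, mul_zero, zero_mul, hone, hone, ← hs] at h1
    have h2 : ∫ x in unitSquare, f x = c * s := by
      linarith [abs_eq_zero.mp (le_antisymm h1 (abs_nonneg _))]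
    have h3 : inner ℝ (H1.val u - m • H1.val H1.one) (hf.memLp.toLp f)
        = (∫ x in unitSquare, H1.val u x * f x)
          - c * ∫ x in unitSquare, H1.val u x * eta₂ x := by
      rw [inner_sub_left, real_inner_smul_left, inner_toLp_right, inner_toLp_right, hone, h2, hm]
      field_simp
    rw [h3]
    exact (le_abs_self _).trans (hc u)
  refine ⟨m, abs_le_of_sq_le_sq' ?_ (by positivity) |>.2⟩
  have hsq := H1.norm_sq_eq (u - m • H1.one)
  rw [map_sub, map_smul, map_sub, map_smul, H1.grad_one, smul_zero, sub_zero] at hsq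
  have h4 := pow_le_pow_left₀ (norm_nonneg _) hval 2
  nlinarith [mul_nonneg hC (sq_nonneg ‖H1.grad u‖)]

lemma abs_integralL_le (u : H1 unitSquare) :
    |integralL u| ≤ ‖H1.val H1.one‖ * ‖u‖ := by
  have h : integralL u = inner ℝ (H1.val u) (H1.val H1.one) := by
    rw [H1.val_one, inner_toLp_right]
    simp [integralL]
  rw [h, mul_comm]
  exact (abs_real_inner_le_norm _ _).trans
    (mul_le_mul_of_nonneg_right (H1.norm_val_le u) (norm_nonneg _))

lemma integralL_one_pos : 0 < integralL H1.one := by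
  have h : integralL H1.one = volume.real unitSquare := by
    have : integralL H1.one = ∫ x in unitSquare, (1 : ℝ) := integral_congr_ae H1.val_one_ae
    rw [this, setIntegral_const, smul_eq_mul, mul_one]
  rw [h]
  refine ENNReal.toReal_pos (isOpen_unitSquare.measure_pos volume ?_).ne'
    volume_unitSquare_lt_top.ne
  exact ⟨WithLp.toLp 2 fun _ => 1 / 2, fun i => by norm_num⟩

/-- A Friedrichs inequality on the unit square. -/
lemma exists_norm_le_grad_add_integral : ∃ C : ℝ, 0 < C ∧ ∀ u : H1 unitSquare,
    ‖u‖ ≤ C * (‖H1.grad u‖ + |integralL u|) := by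
  obtain ⟨C, hC, h⟩ := exists_norm_sub_smul_one_le
  set s := integralL H1.one with hs
  have hs0 : 0 < s := integralL_one_pos
  set K := ‖H1.val H1.one‖ with hK
  have hK0 : 0 ≤ K := norm_nonneg _
  set N := ‖H1.one‖ with hN
  have hN0 : 0 ≤ N := norm_nonneg _
  refine ⟨C + (1 + K * C) / s * N + 1, by positivity, fun u => ?_⟩
  obtain ⟨m, hm⟩ := h u
  have hg : 0 ≤ ‖H1.grad u‖ := norm_nonneg _
  -- Integrating u − m bounds |m| times the area by |∫u| plus a multiple of ‖∇u‖, so m is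
  -- controlled.
  have h1 := abs_integralL_le (u - m • H1.one)
  rw [map_sub, map_smul, smul_eq_mul, ← hs, ← hK] at h1
  have h2 : |m| * s ≤ |integralL u| + K * (C * ‖H1.grad u‖) := by
    rw [← abs_of_pos hs0, ← abs_mul]
    have := abs_sub_abs_le_abs_sub (m * s) (integralL u)
    rw [abs_sub_comm] at this
    nlinarith [mul_le_mul_of_nonneg_left hm hK0]
  have h3 : |m| ≤ (1 + K * C) / s * (‖H1.grad u‖ + |integralL u|) := by
    rw [div_mul_eq_mul_div, le_div_iff₀ hs0]
    nlinarith [mul_nonneg hK0 hC, mul_nonneg (mul_nonneg hK0 hC) (abs_nonneg (integralL u))]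
  have h4 : ‖u‖ ≤ ‖u - m • H1.one‖ + |m| * N := by
    rw [← Real.norm_eq_abs, hN, ← norm_smul]
    simpa using norm_add_le (u - m • H1.one) (m • H1.one)
  have h5 := mul_le_mul_of_nonneg_right h3 hN0
  nlinarith [mul_nonneg hC (abs_nonneg (integralL u)), abs_nonneg (integralL u)]

/-! ### Boundedness, symmetry, coercivity and semi-coercivity of the forms -/

lemma isBoundedForm_cForm (τ : ℝ) : IsBoundedForm (cForm τ) := by
  refine ⟨|τ|, fun q r => ?_⟩
  change |τ * inner ℝ (H1.grad q) (H1.grad r)| ≤ _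
  rw [abs_mul, mul_assoc]
  exact mul_le_mul_of_nonneg_left ((abs_real_inner_le_norm _ _).trans
    (mul_le_mul (H1.norm_grad_le q) (H1.norm_grad_le r) (norm_nonneg _) (norm_nonneg _)))
    (abs_nonneg _)

lemma isBoundedForm_bHat (ΩI : Set Plane) : IsBoundedForm (bHat ΩI) := by
  refine ⟨1, fun v q => ?_⟩
  change |inner ℝ (H1.val v.1) (H1.val q)| ≤ _
  rw [one_mul]
  exact (abs_real_inner_le_norm _ _).trans
    (mul_le_mul (H1.norm_val_le v.1) (H1.norm_val_le q) (norm_nonneg _) (norm_nonneg _))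

lemma isBoundedForm_aHat (ε : ℝ) (ΩI : Set Plane) : IsBoundedForm (aHat ε ΩI) := by
  refine ⟨|ε| * (1 + ‖H1.val H1.one‖ * ‖H1.val H1.one‖), fun u v => ?_⟩
  change |ε * (inner ℝ (H1.grad u.1) (H1.grad v.1) + integralL u.1 * integralL v.1)| ≤ _
  rw [abs_mul, mul_assoc, mul_assoc]
  refine mul_le_mul_of_nonneg_left ((abs_add_le _ _).trans ?_) (abs_nonneg _)
  have h1 := (abs_real_inner_le_norm (H1.grad u.1) (H1.grad v.1)).trans
    (mul_le_mul (H1.norm_grad_le u.1) (H1.norm_grad_le v.1) (norm_nonneg _) (norm_nonneg _))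
  have h2 := mul_le_mul (abs_integralL_le u.1) (abs_integralL_le v.1) (abs_nonneg _)
    (by positivity)
  rw [← abs_mul] at h2
  calc _ ≤ _ := add_le_add h1 h2
    _ = (1 + ‖H1.val H1.one‖ * ‖H1.val H1.one‖) * (‖u.1‖ * ‖v.1‖) := by ring

lemma isSymm_aHat (ε : ℝ) (ΩI : Set Plane) : (aHat ε ΩI).IsSymm := by
  refine ⟨fun u v => ?_⟩
  change ε * (inner ℝ (H1.grad u.1) (H1.grad v.1) + integralL u.1 * integralL v.1)
    = ε * (inner ℝ (H1.grad v.1) (H1.grad u.1) + integralL v.1 * integralL u.1)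
  rw [real_inner_comm, mul_comm (integralL u.1)]

lemma isSymm_cForm (τ : ℝ) : (cForm τ).IsSymm := by
  refine ⟨fun u v => ?_⟩
  change τ * inner ℝ (H1.grad u) (H1.grad v) = τ * inner ℝ (H1.grad v) (H1.grad u)
  rw [real_inner_comm]

lemma isCoerciveForm_aHat {ε : ℝ} (hε : 0 < ε) (ΩI : Set Plane) :
    IsCoerciveForm (aHat ε ΩI) := by
  obtain ⟨C, hC, h⟩ := exists_norm_le_grad_add_integral
  -- The 2 comes from (a + b)² ≤ 2(a² + b²) applied to the squared Friedrichs inequality.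
  refine ⟨ε / (2 * C ^ 2), by positivity, fun u => ?_⟩
  change _ ≤ ε * (inner ℝ (H1.grad u.1) (H1.grad u.1) + integralL u.1 * integralL u.1)
  rw [real_inner_self_eq_norm_sq, ← abs_mul_abs_self (integralL u.1), div_mul_eq_mul_div,
    div_le_iff₀ (by positivity), mul_assoc]
  refine mul_le_mul_of_nonneg_left ?_ hε.le
  have h1 := pow_le_pow_left₀ (norm_nonneg _) (h u.1) 2
  change ‖u.1‖ ^ 2 ≤ _
  nlinarith [mul_nonneg (sq_nonneg C) (sq_nonneg (‖H1.grad u.1‖ - |integralL u.1|))]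

/-- The pullback of `cForm τ` to a closed subspace is semi-coercive. -/
lemma isSemicoerciveForm_of_eq_cForm {X : Type*} [NormedAddCommGroup X] [NormedSpace ℝ X] {τ : ℝ}
    (hτ : 0 < τ) (ι : X →ₗᵢ[ℝ] H1 unitSquare) (hι : IsClosed (Set.range ι))
    {B : X →ₗ[ℝ] X →ₗ[ℝ] ℝ} (hB : ∀ x y, B x y = cForm τ (ι x) (ι y)) :
    IsSemicoerciveForm B := by
  obtain ⟨C, hC, h⟩ := exists_norm_sub_smul_one_le
  have hBdef : ∀ x y : X, B x y = τ * inner ℝ (H1.grad (ι x)) (H1.grad (ι y)) := hB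
  have hker : ∀ x : X, x ∈ LinearMap.ker B ↔ H1.grad (ι x) = 0 := by
    intro x
    rw [LinearMap.mem_ker]
    constructor
    · intro hx
      have h0 : B x x = 0 := by rw [hx]; rfl
      rw [hBdef, mul_eq_zero, inner_self_eq_zero] at h0
      exact h0.resolve_left hτ.ne'
    · intro hx
      ext y
      rw [hBdef, hx, inner_zero_left, mul_zero]
      rfl
  -- With zero gradient, Poincaré–Wirtinger makes ι x a constant, so the kernel embeds into the line
  -- spanned by 1.
  have hfin : FiniteDimensional ℝ (LinearMap.ker B) := by
    let L : LinearMap.ker B →ₗ[ℝ] Submodule.span ℝ {H1.one} :=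
      LinearMap.codRestrict _ (ι.toLinearMap ∘ₗ (LinearMap.ker B).subtype) fun x => by
        obtain ⟨m, hm⟩ := h (ι x.1)
        rw [(hker x.1).mp x.2, norm_zero, mul_zero] at hm
        have := sub_eq_zero.mp (norm_le_zero_iff.mp hm)
        exact Submodule.mem_span_singleton.mpr ⟨m, this.symm⟩
    refine FiniteDimensional.of_injective L fun x y hxy => ?_
    have hxy' : ι x.1 = ι y.1 := congrArg Subtype.val hxy
    exact Subtype.ext (ι.injective hxy')
  have hdist : ∃ D : ℝ, 0 ≤ D ∧ ∀ x : X,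
      Metric.infDist x (LinearMap.ker B : Set X) ≤ D * ‖H1.grad (ι x)‖ := by
    -- If 1 lies in the subspace, the nearby constant is itself a kernel element. Otherwise the
    -- positive distance d from 1 to the closed subspace bounds |m|, hence ‖x‖, by ‖∇u‖, and
    -- comparison with the kernel element 0 is enough.
    by_cases hone : H1.one ∈ Set.range ι
    · obtain ⟨o, ho⟩ := hone
      refine ⟨C, hC, fun x => ?_⟩
      obtain ⟨m, hm⟩ := h (ι x)
      have hmem : m • o ∈ (LinearMap.ker B : Set X) :=
        (hker _).mpr (by rw [map_smul, ho, map_smul, H1.grad_one, smul_zero])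
      refine (Metric.infDist_le_dist_of_mem hmem).trans ?_
      rwa [← ι.dist_map, map_smul, ho, dist_eq_norm]
    · have hne : (Set.range ι).Nonempty := ⟨ι 0, 0, rfl⟩
      set d := Metric.infDist H1.one (Set.range ι) with hd
      have hd0 : 0 < d := (hι.notMem_iff_infDist_pos hne).mp hone
      refine ⟨C + C / d * ‖H1.one‖, by positivity, fun x => ?_⟩
      obtain ⟨m, hm⟩ := h (ι x)
      have hmd : |m| * d ≤ C * ‖H1.grad (ι x)‖ := by
        refine le_trans ?_ hm
        rcases eq_or_ne m 0 with rfl | hm0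
        · simp
        · have h1 : d ≤ dist H1.one (m⁻¹ • ι x) :=
            Metric.infDist_le_dist_of_mem ⟨m⁻¹ • x, map_smul ι _ _⟩
          calc |m| * d ≤ |m| * dist H1.one (m⁻¹ • ι x) := by gcongr
            _ = ‖m • (m⁻¹ • ι x - H1.one)‖ := by
              rw [norm_smul, Real.norm_eq_abs, dist_comm, dist_eq_norm]
            _ = ‖ι x - m • H1.one‖ := by rw [smul_sub, smul_inv_smul₀ hm0]
      have hmle : |m| ≤ C / d * ‖H1.grad (ι x)‖ := by
        rw [div_mul_eq_mul_div, le_div_iff₀ hd0]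
        exact hmd
      have hz : Metric.infDist x (LinearMap.ker B : Set X) ≤ ‖ι x‖ := by
        refine (Metric.infDist_le_dist_of_mem (Submodule.zero_mem _)).trans ?_
        rw [dist_zero_right, ι.norm_map]
      have h4 : ‖ι x‖ ≤ ‖ι x - m • H1.one‖ + |m| * ‖H1.one‖ := by
        rw [← Real.norm_eq_abs, ← norm_smul]
        simpa using norm_add_le (ι x - m • H1.one) (m • H1.one)
      have h5 := mul_le_mul_of_nonneg_right hmle (norm_nonneg H1.one)
      linarith
  obtain ⟨D, hD, hle⟩ := hdist
  -- Adding 1 keeps the denominator positive when D = 0.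
  refine ⟨hfin, τ / (D ^ 2 + 1), by positivity, fun x => ?_⟩
  rw [hBdef, real_inner_self_eq_norm_sq, div_mul_eq_mul_div, div_le_iff₀ (by positivity),
    mul_assoc]
  refine mul_le_mul_of_nonneg_left ?_ hτ.le
  have h1 := pow_le_pow_left₀ Metric.infDist_nonneg (hle x) 2
  nlinarith [sq_nonneg ‖H1.grad (ι x)‖]

lemma isSemicoerciveForm_cForm {τ : ℝ} (hτ : 0 < τ) : IsSemicoerciveForm (cForm τ) :=
  isSemicoerciveForm_of_eq_cForm hτ LinearIsometry.id (by simp) fun _ _ => rfl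

lemma isSemicoerciveForm_cForm₀ {τ : ℝ} (hτ : 0 < τ) : IsSemicoerciveForm (cForm₀ τ) := by
  refine isSemicoerciveForm_of_eq_cForm hτ (H10 unitSquare).subtypeₗᵢ ?_ fun _ _ => rfl
  rw [Submodule.coe_subtypeₗᵢ, Submodule.coe_subtype, Subtype.range_coe]
  exact Submodule.isClosed_topologicalClosure _

end CahnHilliard

end

theorem mainTheorem7 (ε τ : ℝ) (hε : 0 < ε) (hτ : 0 < τ)
    (ΩI : Set CahnHilliard.Plane) (hΩI : ΩI ⊆ CahnHilliard.unitSquare) :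
    ((CahnHilliard.aHat ε ΩI).IsSymm ∧ CahnHilliard.IsCoerciveForm (CahnHilliard.aHat ε ΩI)) ∧
    ((CahnHilliard.cForm τ).IsSymm ∧ CahnHilliard.IsSemicoerciveForm (CahnHilliard.cForm τ) ∧
      CahnHilliard.IsSemicoerciveForm (CahnHilliard.cForm₀ τ)) ∧
    (CahnHilliard.IsBoundedForm (CahnHilliard.aHat ε ΩI) ∧
      CahnHilliard.IsBoundedForm (CahnHilliard.bHat ΩI) ∧
      CahnHilliard.IsBoundedForm (CahnHilliard.cForm τ)) :=
  ⟨⟨CahnHilliard.isSymm_aHat ε ΩI, CahnHilliard.isCoerciveForm_aHat hε ΩI⟩,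
    ⟨CahnHilliard.isSymm_cForm τ, CahnHilliard.isSemicoerciveForm_cForm hτ,
      CahnHilliard.isSemicoerciveForm_cForm₀ hτ⟩,
    ⟨CahnHilliard.isBoundedForm_aHat ε ΩI, CahnHilliard.isBoundedForm_bHat ΩI,
      CahnHilliard.isBoundedForm_cForm τ⟩⟩
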